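/- Let $\alpha>0$ be non-integer, $m=\lceil\alpha\rceil$, $n\in\mathbb{N}$, and let $a\neq 0$ and $x>a$ be real numbers with $|x-a|<|a|$ (so that the power series in $\frac{a-x}{a}$ below converge). For a function $f$ on $[a,x]$ put $${}_aI_x^{\alpha}f(x)=\frac1{\Gamma(\alpha)}\int_a^x(x-\tau)^{\alpha-1}f(\tau)\,d\tau,\qquad {}^C_aD_x^{\alpha}f(x)=\frac1{\Gamma(m-\alpha)}\int_a^x(x-\tau)^{m-\alpha-1}f^{(m)}(\tau)\,d\tau$$ (the left-sided Riemann–Liouville fractional integral and Caputo fractional derivative). Let $\Psi=\Gamma'/\Gamma$, let $(s)_k=s(s+1)\cdots(s+k-1)$, let ${}_2F_1$ be the Gauss hypergeometric series, and read $1/\Gamma$ as $0$ at $0,-1,-2,\dots$. Logarithms and powers are real if $a>0$; if $a<0$ (so that $x<0$) they are the principal branches, $\ln t=\ln|t|+i\pi$ and $t^{s}=e^{s\ln t}$ for $t<0$. Then the integrals and series below converge, and $${}_aI_x^{\alpha}\,x^{2n}\ln x=\frac{x^{2n+\alpha}(x-a)^{\alpha}}{a^{\alpha}\Gamma(1+\alpha)}\Bigg({}_2F_1\Big(\alpha,\alpha+2n+1;\alpha+1;\frac{a-x}{a}\Big)\big(\ln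 x-\Psi(\alpha+2n+1)\big)+\alpha\sum_{k=0}^{\infty}\frac{(\alpha+2n+1)_k\,\Psi(\alpha+2n+k+1)\,(a-x)^k}{(\alpha+k)\,a^k\,k!}\Bigg),$$ $${}^C_aD_x^{\alpha}\,x^{2n}\ln x=\frac{\Gamma(2n+1)\,x^{2n-\alpha}(x-a)^{m-\alpha}}{a^{m-\alpha}\Gamma(1+m-\alpha)}\Bigg({}_2F_1\Big(m-\alpha,2n-\alpha+1;m-\alpha+1;\frac{a-x}{a}\Big)\bigg(\frac{\ln x-\Psi(2n-\alpha+1)}{\Gamma(2n-m+1)}+m!\sum_{r=1}^{m}\frac{(-1)^{r-1}}{r\,(m-r)!\,\Gamma(2n-m+r+1)}\bigg)$$ $$\qquad\qquad+\frac{m-\alpha}{\Gamma(2n-m+1)}\sum_{k=0}^{\infty}\frac{(2n-\alpha+1)_k\,\Psi(2n-\alpha+k+1)}{(m-\alpha+k)\,a^k\,k!}(a-x)^k\Bigg).$$ -/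

import Mathlib

open MeasureTheory

noncomputable section

/-- The left-sided Riemann–Liouville fractional integral of order `α` with lower limit `a`,
`(1 / Γ(α)) ∫_a^x (x - τ)^(α - 1) f(τ) dτ` for `x > a`. -/
def rlIntegral (a α : ℝ) (f : ℝ → ℂ) (x : ℝ) : ℂ :=
  ((1 / Real.Gamma α : ℝ) : ℂ) * ∫ τ in a..x, (((x - τ) ^ (α - 1) : ℝ) : ℂ) * f τ

/-- The left-sided Caputo fractional derivative of order `α` with lower limit `a`,
`(1 / Γ(m - α)) ∫_a^x (x - τ)^(m - α - 1) f^(m)(τ) dτ` for `x > a`, where `m = ⌈α⌉`. -/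
def caputoDeriv (a α : ℝ) (f : ℝ → ℂ) (x : ℝ) : ℂ :=
  ((1 / Real.Gamma (⌈α⌉₊ - α) : ℝ) : ℂ) *
    ∫ τ in a..x, (((x - τ) ^ (⌈α⌉₊ - α - 1) : ℝ) : ℂ) * iteratedDeriv ⌈α⌉₊ f τ

/-- The thin-plate spline `x ^ (2 n) * ln x` as a function of a real variable, with the principal
branch of the logarithm: for `x > 0` it is real, for `x < 0` one has `ln x = ln |x| + i π`. -/
def thinPlateSpline (n : ℕ) (x : ℝ) : ℂ := (x : ℂ) ^ (2 * n) * Complex.log x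

/-- The Pochhammer symbol `(s)_k = s (s + 1) ⋯ (s + k - 1)`. -/
def pochhammerSymbol (s : ℂ) (k : ℕ) : ℂ := (ascPochhammer ℂ k).eval s

/-- The reciprocal Gamma function `1 / Γ`, an entire function which vanishes at `0, -1, -2, …`
(`Complex.Gamma` takes the value `0` there, so its inverse is `0` as it should be). -/
def recipGamma (s : ℂ) : ℂ := (Complex.Gamma s)⁻¹

end

/-!
For real `τ` between `a` and `x` the condition `|x - a| < |a|` forces `τ` and `x` to have the same
sign, and `v = (τ - x) / τ = 1 - x / τ` satisfies `|v| ≤ |(a - x) / a| < 1`. In this variable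

`(x - τ) ^ (β - 1) τ ^ s = |x| ^ β x ^ s · w(τ) · (1 - v) ^ (-b)`, with `b = β + s + 1`,

where `w(τ) = ((x - τ) / |τ|) ^ (β - 1) |x| / τ ^ 2` is a nonnegative kernel
(`sub_rpow_mul_zpow`), and `log τ = log x - log (1 - v)` (`log_ofReal_eq_sub`). Both signs of `a`
are thereby treated at once. The function `(1 - v) ^ (-b) (A - B log (1 - v))` is holomorphic in the
unit disc, and its Taylor coefficients are `(b)_k (A + B ∑ j < k, 1 / (b + j)) / k!`
(`hasSum_cpow_mul_log`), the inner sum being `Ψ(b + k) - Ψ(b)` (`digamma_add_natCast`). The kernel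
has the moments `∫ w v ^ k = ((x - a) / |a|) ^ β ((a - x) / a) ^ k / (β + k)`, and dominated
convergence permits integration term by term (`integral_weight_mul_tsum`). Since
`(β)_k / (β + 1)_k = β / (β + k)`, the part without `Ψ(b + k)` is a Gauss series, which gives the
Riemann–Liouville integral of `τ ^ s (A + B log τ)` for every integer `s`
(`rlIntegral_zpow_mul_log`).

The fractional integral is the case `β = α`, `s = 2 n`. For the Caputo derivative, Leibniz' rule
(`iteratedDeriv_thinPlateSpline`) writes the `m`-th derivative of `τ ^ (2 n) log τ` as a multiple of
`τ ^ (2 n - m) (A + B log τ)`, and the case `β = m - α`, `s = 2 n - m` applies; here `s` may be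
negative, and `b = 2 n - α + 1` is not an integer.
-/

/-! ### The binomial series with a logarithm -/

theorem one_sub_mem_slitPlane {v : ℂ} (hv : ‖v‖ < 1) : 1 - v ∈ Complex.slitPlane := by
  left
  have := (Complex.re_le_norm v).trans_lt hv
  simpa using this

/-- Differentiating `(1 - v) ^ (-b) (A - B log (1 - v))` keeps its shape: the Pochhammer symbol
`(b)_k` comes out, and the coefficient of `B` picks up the logarithmic derivative
`∑ j < k, 1 / (b + j)` of `(b)_k` in `b`. -/
theorem iteratedDeriv_cpow_mul_log (b A B : ℂ) (hb : ∀ j : ℕ, b + j ≠ 0) (k : ℕ) :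
    ∀ v : ℂ, ‖v‖ < 1 →
      iteratedDeriv k (fun v : ℂ => (1 - v) ^ (-b) * (A - B * Complex.log (1 - v))) v =
        (1 - v) ^ (-b - k) * (pochhammerSymbol b k *
          (A + B * (∑ j ∈ Finset.range k, (b + j)⁻¹ - Complex.log (1 - v)))) := by
  induction k with
  | zero =>
    intro v _
    simp [pochhammerSymbol, sub_eq_add_neg]
  | succ k ih =>
    intro v hv
    rw [iteratedDeriv_succ]
    have hev : iteratedDeriv k (fun v : ℂ => (1 - v) ^ (-b) * (A - B * Complex.log (1 - v)))
        =ᶠ[nhds v] fun v => (1 - v) ^ (-b - k) * (pochhammerSymbol b k *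
          (A + B * (∑ j ∈ Finset.range k, (b + j)⁻¹ - Complex.log (1 - v)))) := by
      filter_upwards [(isOpen_lt continuous_norm continuous_const).mem_nhds hv] with w hw
      exact ih w hw
    rw [hev.deriv_eq]
    have hs := one_sub_mem_slitPlane hv
    have h1 : HasDerivAt (fun w : ℂ => 1 - w) (-1) v := by
      simpa using (hasDerivAt_id v).const_sub 1
    have h2 := h1.cpow_const (c := -b - k) hs
    have h3 := ((((h1.clog hs).const_sub
      (∑ j ∈ Finset.range k, (b + j)⁻¹)).const_mul B).const_add A).const_mul (pochhammerSymbol b k)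
    rw [(h2.fun_mul h3).deriv]
    have hne : (1 - v) ≠ 0 := Complex.slitPlane_ne_zero hs
    have e1 : (1 - v) ^ (-b - k) = (1 - v) ^ (-b - (k + 1 : ℕ)) * (1 - v) := by
      rw [show -b - (k : ℂ) = -b - (k + 1 : ℕ) + 1 by push_cast; ring, Complex.cpow_add _ _ hne,
        Complex.cpow_one]
    have e2 : (1 - v) ^ (-b - k - 1) = (1 - v) ^ (-b - (k + 1 : ℕ)) := by
      congr 1; push_cast; ring
    have e3 : pochhammerSymbol b (k + 1) = pochhammerSymbol b k * (b + k) :=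
      ascPochhammer_succ_eval k b
    rw [e1, e2, e3, Finset.sum_range_succ]
    have := hb k
    field_simp
    ring

/-- The binomial series `(1 - v) ^ (-b) = ∑ (b)_k v ^ k / k!` together with its derivative in `b`,
in one linear combination. -/
theorem hasSum_cpow_mul_log (b A B : ℂ) (hb : ∀ j : ℕ, b + j ≠ 0) {v : ℂ} (hv : ‖v‖ < 1) :
    HasSum (fun k : ℕ => pochhammerSymbol b k *
        (A + B * ∑ j ∈ Finset.range k, (b + j)⁻¹) / (k.factorial : ℂ) * v ^ k)
      ((1 - v) ^ (-b) * (A - B * Complex.log (1 - v))) := by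
  have hd : DifferentiableOn ℂ (fun v : ℂ => (1 - v) ^ (-b) * (A - B * Complex.log (1 - v)))
      (Metric.ball 0 1) := by
    intro w hw
    have hs := one_sub_mem_slitPlane (mem_ball_zero_iff.1 hw)
    have h1 : DifferentiableAt ℂ (fun w : ℂ => 1 - w) w := by fun_prop
    exact ((h1.cpow_const hs).mul
      ((differentiableAt_const A).sub ((h1.clog hs).const_mul B))).differentiableWithinAt
  have h := Complex.hasSum_taylorSeries_on_ball hd (mem_ball_zero_iff.2 hv)
  refine h.congr_fun fun k => ?_
  rw [iteratedDeriv_cpow_mul_log b A B hb k 0 (by simp)]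
  simp only [sub_zero, Complex.one_cpow, Complex.log_one, smul_eq_mul]
  ring

theorem digamma_add_natCast (b : ℂ) (hb : ∀ j : ℕ, b + j ≠ 0) (k : ℕ) :
    Complex.digamma (b + k) = Complex.digamma b + ∑ j ∈ Finset.range k, (b + j)⁻¹ := by
  induction k with
  | zero => simp
  | succ k ih =>
    rw [Finset.sum_range_succ, ← add_assoc, ← ih, Nat.cast_succ, ← add_assoc]
    refine Complex.digamma_apply_add_one _ fun j hj => hb (k + j) ?_
    push_cast
    linear_combination hj

/-- `(β)_k / (β + 1)_k = β / (β + k)`. -/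
theorem pochhammerSymbol_add_one (β : ℂ) (k : ℕ) :
    β * pochhammerSymbol (β + 1) k = pochhammerSymbol β k * (β + k) := by
  have h := ascPochhammer_succ_eval k β
  rw [ascPochhammer_succ_left, Polynomial.eval_mul, Polynomial.eval_X, Polynomial.eval_comp] at h
  simpa [pochhammerSymbol] using h

theorem ordinaryHypergeometricSeries_add_one (β b z : ℂ) (hβ : ∀ j : ℕ, β + j ≠ 0) (k : ℕ) :
    ordinaryHypergeometricSeries ℂ β b (β + 1) k (fun _ => z) =
      β * (pochhammerSymbol b k / (k.factorial : ℂ) * z ^ k / (β + k)) := by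
  have hk := hβ k
  have hp : pochhammerSymbol (β + 1) k ≠ 0 := by
    rw [pochhammerSymbol, Ne, ascPochhammer_eval_eq_zero_iff]
    rintro ⟨j, -, hj⟩
    apply hβ (j + 1)
    push_cast
    linear_combination hj
  have hf : (k.factorial : ℂ) ≠ 0 := by exact_mod_cast k.factorial_ne_zero
  have h := pochhammerSymbol_add_one β k
  rw [ordinaryHypergeometricSeries_apply_eq, smul_eq_mul]
  change _ * pochhammerSymbol β k * pochhammerSymbol b k * (pochhammerSymbol (β + 1) k)⁻¹ * _ = _
  field_simp
  linear_combination -(pochhammerSymbol b k * z ^ k) * h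

/-! ### Integration term by term -/

/-- The derivative of the substitution `u = (x - τ) / |τ|`, for `x` and `τ` of the same sign. -/
theorem hasDerivAt_sub_div_abs {x τ : ℝ} (hτ : τ ≠ 0) (hxτ : 0 < x * τ) :
    HasDerivAt (fun t : ℝ => (x - t) / |t|) (-(|x| / τ ^ 2)) τ := by
  have h := (((hasDerivAt_id τ).const_sub x).div (hasDerivAt_abs hτ) (abs_ne_zero.2 hτ))
  refine h.congr_deriv ?_
  rcases lt_or_gt_of_ne hτ with h0 | h0
  · have hx : x < 0 := by nlinarith
    rw [abs_of_neg h0, abs_of_neg hx, sign_neg h0]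
    simp
    field_simp
  · have hx : 0 < x := by nlinarith
    rw [abs_of_pos h0, abs_of_pos hx, sign_pos h0]
    simp
    field_simp
    ring

theorem mul_pos_of_mem_Icc {a x : ℝ} (hax : a < x) (hconv : |x - a| < |a|) {τ : ℝ}
    (hτ : τ ∈ Set.Icc a x) : 0 < x * τ := by
  obtain ⟨h1, h2⟩ := hτ
  rw [abs_of_pos (sub_pos.2 hax)] at hconv
  rcases le_or_gt 0 a with h | h
  · rw [abs_of_nonneg h] at hconv
    have : 0 < a := by linarith
    exact mul_pos (by linarith) (by linarith)
  · rw [abs_of_neg h] at hconv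
    exact mul_pos_of_neg_of_neg (by linarith) (by linarith)

theorem ne_zero_of_mem_Icc {a x : ℝ} (hax : a < x) (hconv : |x - a| < |a|) {τ : ℝ}
    (hτ : τ ∈ Set.Icc a x) : τ ≠ 0 := fun h => by
  simpa [h] using mul_pos_of_mem_Icc hax hconv hτ

theorem intervalIntegrable_sub_rpow_smul {E : Type*} [NormedAddCommGroup E] [NormedSpace ℝ E]
    {a x p : ℝ} (hp : 0 < p) (hax : a < x) {g : ℝ → E} (hg : ContinuousOn g (Set.Icc a x)) :
    IntervalIntegrable (fun τ => (x - τ) ^ (p - 1) • g τ) volume a x := by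
  have h0 : IntervalIntegrable (fun τ : ℝ => τ ^ (p - 1)) volume 0 (x - a) :=
    intervalIntegral.intervalIntegrable_rpow' (by linarith)
  have h1 := (h0.comp_sub_left x).symm
  simp only [sub_zero, sub_sub_cancel] at h1
  exact h1.smul_continuousOn (by rwa [Set.uIcc_of_le hax.le])

theorem intervalIntegrable_weight {a x p : ℝ} (hp : 0 < p) (hax : a < x)
    (hconv : |x - a| < |a|) :
    IntervalIntegrable (fun τ : ℝ => ((x - τ) / |τ|) ^ (p - 1) * (|x| / τ ^ 2)) volume a x := by
  have hc : ContinuousOn (fun τ : ℝ => (|τ| ^ (p - 1))⁻¹ * (|x| / τ ^ 2)) (Set.Icc a x) := by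
    intro τ hτ
    have h := ne_zero_of_mem_Icc hax hconv hτ
    have h' := abs_pos.2 h
    refine ContinuousAt.continuousWithinAt (ContinuousAt.mul (ContinuousAt.inv₀ ?_ ?_) ?_)
    · exact continuous_abs.continuousAt.rpow_const (Or.inl h'.ne')
    · positivity
    · exact continuousAt_const.div (by fun_prop) (by positivity)
  refine (intervalIntegrable_sub_rpow_smul hp hax hc).congr_uIoo ?_
  intro τ hτ
  rw [Set.uIoo_of_le hax.le] at hτ
  simp only [smul_eq_mul]
  rw [Real.div_rpow (sub_nonneg.2 hτ.2.le) (abs_nonneg _)]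
  ring

/-- The kernel is `-u ^ (p - 1) du` for `u = (x - τ) / |τ|`. -/
theorem integral_weight {a x p : ℝ} (hp : 0 < p) (hax : a < x) (hconv : |x - a| < |a|) :
    ∫ τ in a..x, ((x - τ) / |τ|) ^ (p - 1) * (|x| / τ ^ 2) = ((x - a) / |a|) ^ p / p := by
  have hcont : ContinuousOn (fun τ : ℝ => -(((x - τ) / |τ|) ^ p / p)) (Set.Icc a x) := by
    intro τ hτ
    have h := ne_zero_of_mem_Icc hax hconv hτ
    have h1 : ContinuousAt (fun t : ℝ => (x - t) / |t|) τ :=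
      ContinuousAt.div (by fun_prop) (by fun_prop) (abs_ne_zero.2 h)
    exact ((h1.rpow_const (Or.inr hp.le)).div_const p).neg.continuousWithinAt
  rw [intervalIntegral.integral_eq_sub_of_hasDerivAt_of_le hax.le hcont ?_
    (intervalIntegrable_weight hp hax hconv)]
  · simp [Real.zero_rpow hp.ne']
  · intro τ hτ
    have hτ' := Set.Ioo_subset_Icc_self hτ
    have h0 := ne_zero_of_mem_Icc hax hconv hτ'
    have hq : 0 < (x - τ) / |τ| := div_pos (sub_pos.2 hτ.2) (abs_pos.2 h0)
    have h := (((hasDerivAt_sub_div_abs h0 (mul_pos_of_mem_Icc hax hconv hτ')).rpow_const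
      (p := p) (Or.inl hq.ne')).div_const p).neg
    refine h.congr_deriv ?_
    field_simp

/-- `v = (τ - x) / τ` is `u = (x - τ) / |τ|` up to the sign `-x / |x|`, which does not depend on
`τ`. -/
theorem sub_div_eq_sign_mul {x τ : ℝ} (hxτ : 0 < x * τ) :
    (τ - x) / τ = -(x / |x|) * ((x - τ) / |τ|) := by
  rcases pos_and_pos_or_neg_and_neg_of_mul_pos hxτ with ⟨hx, ht⟩ | ⟨hx, ht⟩
  · rw [abs_of_pos hx, abs_of_pos ht]; field_simp; ring
  · rw [abs_of_neg hx, abs_of_neg ht]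
    have := hx.ne; have := ht.ne
    field_simp; ring

/-- The moments of the kernel in the variable `v = (τ - x) / τ`. -/
theorem integral_weight_mul_pow {a x β : ℝ} (hβ : 0 < β) (hax : a < x) (hconv : |x - a| < |a|)
    (k : ℕ) :
    ∫ τ in a..x, ((x - τ) / |τ|) ^ (β - 1) * (|x| / τ ^ 2) * ((τ - x) / τ) ^ k =
      ((x - a) / |a|) ^ β * ((a - x) / a) ^ k / (β + k) := by
  have ha : a ∈ Set.Icc a x := ⟨le_rfl, hax.le⟩
  have hqa : 0 < (x - a) / |a| :=
    div_pos (sub_pos.2 hax) (abs_pos.2 (ne_zero_of_mem_Icc hax hconv ha))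
  have hβk : 0 < β + k := by positivity
  have key : ∫ τ in a..x, ((x - τ) / |τ|) ^ (β - 1) * (|x| / τ ^ 2) * ((τ - x) / τ) ^ k =
      ∫ τ in a..x, (-(x / |x|)) ^ k * (((x - τ) / |τ|) ^ ((β + k) - 1) * (|x| / τ ^ 2)) := by
    refine intervalIntegral.integral_congr_Ioo_of_le hax.le ?_
    intro τ hτ
    have hτ' := Set.Ioo_subset_Icc_self hτ
    have hq : 0 < (x - τ) / |τ| :=
      div_pos (sub_pos.2 hτ.2) (abs_pos.2 (ne_zero_of_mem_Icc hax hconv hτ'))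
    simp only
    rw [sub_div_eq_sign_mul (mul_pos_of_mem_Icc hax hconv hτ'), mul_pow,
      show β + k - 1 = (β - 1) + k by ring, Real.rpow_add hq, Real.rpow_natCast]
    ring
  rw [key, intervalIntegral.integral_const_mul, integral_weight hβk hax hconv,
    sub_div_eq_sign_mul (mul_pos_of_mem_Icc hax hconv ha), mul_pow, Real.rpow_add hqa,
    Real.rpow_natCast]
  ring

theorem abs_sub_div_le {a x τ : ℝ} (hax : a < x) (hconv : |x - a| < |a|)
    (hτ : τ ∈ Set.Icc a x) : |(τ - x) / τ| ≤ |(a - x) / a| := by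
  have ha := mul_pos_of_mem_Icc hax hconv (τ := a) ⟨le_rfl, hax.le⟩
  have ht := mul_pos_of_mem_Icc hax hconv hτ
  rw [abs_div, abs_div, abs_of_nonpos (by linarith [hτ.2] : τ - x ≤ 0),
    abs_of_neg (by linarith : a - x < 0)]
  rcases pos_and_pos_or_neg_and_neg_of_mul_pos ha with ⟨hx, h0⟩ | ⟨hx, h0⟩
  · have h1 : 0 < τ := by linarith [hτ.1]
    rw [abs_of_pos h1, abs_of_pos h0, div_le_div_iff₀ h1 h0]
    nlinarith [hτ.1]
  · have h1 : τ < 0 := by linarith [hτ.2]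
    rw [abs_of_neg h1, abs_of_neg h0, div_le_div_iff₀ (by linarith) (by linarith)]
    nlinarith [hτ.1]

theorem abs_sub_div_lt_one {a x : ℝ} (hconv : |x - a| < |a|) : |(a - x) / a| < 1 := by
  rw [abs_div, abs_sub_comm, div_lt_one ((abs_nonneg _).trans_lt hconv)]
  exact hconv

/-- A power series in `v = (τ - x) / τ` that converges at the endpoint `τ = a` may be integrated
term by term against the kernel; it is dominated there by its values at `a`. -/
theorem integral_weight_mul_tsum {a x β : ℝ} (hβ : 0 < β) (hax : a < x) (hconv : |x - a| < |a|)
    (c : ℕ → ℂ) (f : ℂ → ℂ)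
    (hf : ∀ v : ℂ, ‖v‖ < 1 → HasSum (fun k => c k * v ^ k) (f v)) :
    HasSum (fun k => (((x - a) / |a|) ^ β : ℝ) * (c k * (((a - x) / a : ℝ) : ℂ) ^ k / (β + k)))
      (∫ τ in a..x, ((((x - τ) / |τ|) ^ (β - 1) * (|x| / τ ^ 2) : ℝ) : ℂ) *
        f (((τ - x) / τ : ℝ) : ℂ)) := by
  set z : ℝ := (a - x) / a with hz
  have hz1 : |z| < 1 := abs_sub_div_lt_one hconv
  have hsum : Summable fun k => ‖c k * (z : ℂ) ^ k‖ :=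
    (hf z (by simpa using hz1)).summable.norm
  have hw := intervalIntegrable_weight hβ hax hconv
  have main := intervalIntegral.hasSum_integral_of_dominated_convergence (a := a) (b := x)
    (μ := volume)
    (F := fun k (τ : ℝ) => ((((x - τ) / |τ|) ^ (β - 1) * (|x| / τ ^ 2) : ℝ) : ℂ) *
      (c k * (((τ - x) / τ : ℝ) : ℂ) ^ k))
    (f := fun τ : ℝ => ((((x - τ) / |τ|) ^ (β - 1) * (|x| / τ ^ 2) : ℝ) : ℂ) *
        f (((τ - x) / τ : ℝ) : ℂ))
    (fun k τ => ‖c k * (z : ℂ) ^ k‖ * (((x - τ) / |τ|) ^ (β - 1) * (|x| / τ ^ 2)))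
    ?_ ?_ ?_ ?_ ?_
  · refine main.congr_fun fun k => ?_
    have h1 : (fun τ : ℝ => ((((x - τ) / |τ|) ^ (β - 1) * (|x| / τ ^ 2) : ℝ) : ℂ) *
        (c k * (((τ - x) / τ : ℝ) : ℂ) ^ k)) = fun τ => c k *
        ((((x - τ) / |τ|) ^ (β - 1) * (|x| / τ ^ 2) * ((τ - x) / τ) ^ k : ℝ) : ℂ) := by
      ext τ; push_cast; ring
    rw [h1, intervalIntegral.integral_const_mul, intervalIntegral.integral_ofReal,
      integral_weight_mul_pow hβ hax hconv, ← hz]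
    push_cast
    ring
  · intro k
    exact Measurable.aestronglyMeasurable (by fun_prop)
  · intro k
    refine ae_of_all _ fun τ hτ => ?_
    rw [Set.uIoc_of_le hax.le] at hτ
    have hτ' := Set.Ioc_subset_Icc_self hτ
    have hpos : 0 ≤ ((x - τ) / |τ|) ^ (β - 1) * (|x| / τ ^ 2) := by
      have : 0 ≤ x - τ := sub_nonneg.2 hτ.2
      positivity
    rw [norm_mul, Complex.norm_real, Real.norm_of_nonneg hpos, mul_comm, norm_mul, norm_mul,
      norm_pow, norm_pow, Complex.norm_real, Complex.norm_real]
    gcongr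
    exact abs_sub_div_le hax hconv hτ'
  · exact ae_of_all _ fun τ _ => hsum.mul_right _
  · simp only [tsum_mul_right]
    exact hw.const_mul _
  · refine ae_of_all _ fun τ hτ => ?_
    rw [Set.uIoc_of_le hax.le] at hτ
    refine (hf _ ?_).mul_left _
    rw [Complex.norm_real]
    exact (abs_sub_div_le hax hconv (Set.Ioc_subset_Icc_self hτ)).trans_lt hz1

/-! ### The fractional integral of a power times a logarithm -/

/-- For negative `x` and `a` the principal branches contribute factors `exp (π i β)` to `x ^ β` and
to `a ^ β`, which cancel; what is left is real. -/
theorem cpow_mul_cpow_div_cpow {a x : ℝ} (β : ℝ) (s : ℤ) (hax : a < x) (hxa : 0 < x * a) :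
    (x : ℂ) ^ (β + s : ℂ) * ((x : ℂ) - a) ^ (β : ℂ) / (a : ℂ) ^ (β : ℂ) =
      ((|x| ^ β * x ^ s * ((x - a) / |a|) ^ β : ℝ) : ℂ) := by
  have hx : (x : ℂ) ≠ 0 := by
    rintro h
    rw [Complex.ofReal_eq_zero] at h
    simp [h] at hxa
  have hpos : 0 ≤ x - a := by linarith
  rw [Complex.cpow_add _ _ hx, Complex.cpow_intCast, Real.div_rpow hpos (abs_nonneg _),
    ← Complex.ofReal_sub, ← Complex.ofReal_cpow hpos]
  push_cast
  rcases pos_and_pos_or_neg_and_neg_of_mul_pos hxa with ⟨h1, h2⟩ | ⟨h1, h2⟩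
  · rw [abs_of_pos h1, abs_of_pos h2, ← Complex.ofReal_cpow h1.le, ← Complex.ofReal_cpow h2.le]
    ring
  · rw [abs_of_neg h1, abs_of_neg h2, Complex.ofReal_cpow_of_nonpos h1.le,
      Complex.ofReal_cpow_of_nonpos h2.le, ← Complex.ofReal_neg, ← Complex.ofReal_neg,
      ← Complex.ofReal_cpow (by linarith), ← Complex.ofReal_cpow (by linarith)]
    have := Complex.exp_ne_zero (Real.pi * Complex.I * β)
    field_simp

theorem log_ofReal_eq_sub {x τ : ℝ} (hxτ : 0 < x * τ) :
    Complex.log τ = Complex.log x - Complex.log ((x / τ : ℝ) : ℂ) := by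
  have hτ : τ ≠ 0 := by rintro rfl; simp at hxτ
  have hpos : 0 < x / τ := by
    have : x / τ = x * τ / τ ^ 2 := by field_simp
    rw [this]; positivity
  have h := Complex.log_ofReal_mul hpos (Complex.ofReal_ne_zero.2 hτ)
  rw [← Complex.ofReal_mul, div_mul_cancel₀ _ hτ, Complex.ofReal_log hpos.le] at h
  rw [h]; ring

/-- In terms of `v = (τ - x) / τ`, where `1 - v = x / τ`, the factor `(x - τ) ^ (β - 1) τ ^ s`
is the kernel times `(1 - v) ^ (-(β + s + 1))`. -/
theorem sub_rpow_mul_zpow {x τ β : ℝ} (s : ℤ) (hxτ : 0 < x * τ) (h : τ < x) :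
    (x - τ) ^ (β - 1) * τ ^ s = |x| ^ β * x ^ s *
      (((x - τ) / |τ|) ^ (β - 1) * (|x| / τ ^ 2)) * (x / τ) ^ (-(β + s + 1)) := by
  have hτ : τ ≠ 0 := by rintro rfl; simp at hxτ
  have hx : x ≠ 0 := by rintro rfl; simp at hxτ
  have hpos : 0 < x / τ := by
    have : x / τ = x * τ / τ ^ 2 := by field_simp
    rw [this]; positivity
  have habs : x / τ = |x| / |τ| := by rw [← abs_div, abs_of_pos hpos]
  have hx' := abs_pos.2 hx
  have hτ' := abs_pos.2 hτ
  have e1 : (x / τ) ^ (-(β + s + 1)) = (|x| / |τ|) ^ (-(β + 1)) * (x / τ) ^ (-s) := by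
    rw [show -(β + s + 1) = -(β + 1) + ((-s : ℤ) : ℝ) by push_cast; ring, Real.rpow_add hpos,
      Real.rpow_intCast, ← habs]
  rw [e1, Real.div_rpow (by linarith) hτ'.le, Real.div_rpow hx'.le hτ'.le, Real.rpow_neg hx'.le,
    Real.rpow_neg hτ'.le, Real.rpow_add_one hx'.ne', Real.rpow_add_one hτ'.ne',
    Real.rpow_sub_one hτ'.ne', zpow_neg, div_zpow, ← sq_abs τ]
  have h1 := (Real.rpow_pos_of_pos hx' β).ne'
  have h2 := (Real.rpow_pos_of_pos hτ' β).ne'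
  have h3 := zpow_ne_zero s hx
  have h4 := zpow_ne_zero s hτ
  field_simp

/-- Dividing the coefficients of a summable series by `β + k` keeps it summable. -/
theorem Summable.div_add_natCast {β : ℝ} (hβ : 0 < β) {f : ℕ → ℂ} (hf : Summable f) :
    Summable fun k : ℕ => f k / (β + k) := by
  refine Summable.of_norm_bounded (hf.norm.div_const β) fun k => ?_
  have : ‖(β + k : ℂ)‖ = β + k := by
    rw [← Complex.ofReal_natCast, ← Complex.ofReal_add, Complex.norm_real,
      Real.norm_of_nonneg (by positivity)]
  rw [norm_div, this]
  gcongr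
  simp

section Series

variable {a x β : ℝ} {b : ℂ}

theorem norm_sub_div_lt_one (hconv : |x - a| < |a|) : ‖((a : ℂ) - x) / a‖ < 1 := by
  rw [← Complex.ofReal_sub, ← Complex.ofReal_div, Complex.norm_real]
  exact abs_sub_div_lt_one hconv

theorem summable_pochhammerSymbol (hb : ∀ j : ℕ, b + j ≠ 0) (hβ : 0 < β)
    (hconv : |x - a| < |a|) :
    Summable fun k : ℕ =>
      pochhammerSymbol b k / (k.factorial : ℂ) * (((a : ℂ) - x) / a) ^ k / (β + k) := by
  have h := (hasSum_cpow_mul_log b 1 0 hb (norm_sub_div_lt_one hconv)).summable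
  simp only [zero_mul, add_zero, mul_one] at h
  exact h.div_add_natCast hβ

/-- `(b)_k Ψ(b + k) / k!` is the Taylor coefficient of
`(1 - v) ^ (-b) (Ψ(b) - log (1 - v))`. -/
theorem summable_pochhammerSymbol_mul_digamma (hb : ∀ j : ℕ, b + j ≠ 0) (hβ : 0 < β)
    (hconv : |x - a| < |a|) :
    Summable fun k : ℕ => pochhammerSymbol b k * Complex.digamma (b + k) / (k.factorial : ℂ) *
      (((a : ℂ) - x) / a) ^ k / (β + k) := by
  have h := (hasSum_cpow_mul_log b (Complex.digamma b) 1 hb (norm_sub_div_lt_one hconv)).summable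
  simp only [one_mul, ← digamma_add_natCast b hb] at h
  exact h.div_add_natCast hβ

/-- The Riemann–Liouville kernel integrated against `τ ^ s (A + B log τ)`, for an integer `s`
of either sign. -/
theorem integral_sub_rpow_mul_zpow_mul_log (hβ : 0 < β) (hax : a < x) (hconv : |x - a| < |a|)
    (s : ℤ) (hbs : b = β + s + 1) (hb : ∀ j : ℕ, b + j ≠ 0) (A B : ℂ) :
    ∫ τ in a..x, (((x - τ) ^ (β - 1) : ℝ) : ℂ) * ((τ : ℂ) ^ s * (A + B * Complex.log τ)) =
      (x : ℂ) ^ (β + s : ℂ) * ((x : ℂ) - a) ^ (β : ℂ) / (a : ℂ) ^ (β : ℂ) *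
        ((A + B * (Complex.log x - Complex.digamma b)) *
          (∑' k : ℕ, pochhammerSymbol b k / (k.factorial : ℂ) *
            (((a : ℂ) - x) / a) ^ k / (β + k)) +
        B * ∑' k : ℕ, pochhammerSymbol b k * Complex.digamma (b + k) / (k.factorial : ℂ) *
            (((a : ℂ) - x) / a) ^ k / (β + k)) := by
  have hxa := mul_pos_of_mem_Icc hax hconv (τ := a) ⟨le_rfl, hax.le⟩
  have hC := summable_pochhammerSymbol hb hβ hconv
  have hD := summable_pochhammerSymbol_mul_digamma hb hβ hconv
  have hS := integral_weight_mul_tsum hβ hax hconv _ _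
    fun v hv => hasSum_cpow_mul_log b (A + B * Complex.log x) B hb hv
  -- the integrand is a constant times the integrand of `hS`
  have hint : ∫ τ in a..x, (((x - τ) ^ (β - 1) : ℝ) : ℂ) *
        ((τ : ℂ) ^ s * (A + B * Complex.log τ)) =
      ∫ τ in a..x, ((|x| ^ β * x ^ s : ℝ) : ℂ) *
        (((((x - τ) / |τ|) ^ (β - 1) * (|x| / τ ^ 2) : ℝ) : ℂ) *
        ((1 - (((τ - x) / τ : ℝ) : ℂ)) ^ (-b) *
          (A + B * Complex.log x - B * Complex.log (1 - (((τ - x) / τ : ℝ) : ℂ))))) := by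
    refine intervalIntegral.integral_congr_Ioo_of_le hax.le ?_
    intro τ hτ
    have hτ' := Set.Ioo_subset_Icc_self hτ
    have hxτ := mul_pos_of_mem_Icc hax hconv hτ'
    have h0 := ne_zero_of_mem_Icc hax hconv hτ'
    have hpos : 0 < x / τ := by
      have : x / τ = x * τ / τ ^ 2 := by field_simp
      rw [this]; positivity
    have h1 : 1 - (((τ - x) / τ : ℝ) : ℂ) = ((x / τ : ℝ) : ℂ) := by
      rw [← Complex.ofReal_one, ← Complex.ofReal_sub]
      congr 1
      field_simp
      ring
    have h2 : ((x / τ : ℝ) : ℂ) ^ (-b) = (((x / τ) ^ (-(β + s + 1)) : ℝ) : ℂ) := by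
      rw [Complex.ofReal_cpow hpos.le, hbs]
      push_cast
      rfl
    have h3 := congrArg (fun r : ℝ => (r : ℂ)) (sub_rpow_mul_zpow (β := β) s hxτ hτ.2)
    simp only
    rw [h1, h2, log_ofReal_eq_sub hxτ]
    simp only [Complex.ofReal_mul, Complex.ofReal_zpow] at h3 ⊢
    linear_combination (A + B * (Complex.log x - Complex.log ((x / τ : ℝ) : ℂ))) * h3
  rw [hint, intervalIntegral.integral_const_mul, ← hS.tsum_eq, tsum_mul_left,
    cpow_mul_cpow_div_cpow β s hax hxa, ← tsum_mul_left (a := A + _), ← tsum_mul_left (a := B),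
    ← (hC.mul_left _).tsum_add (hD.mul_left _)]
  rw [Complex.ofReal_mul _ (((x - a) / |a|) ^ β), mul_assoc]
  congr 2
  refine tsum_congr fun k => ?_
  rw [digamma_add_natCast b hb k]
  push_cast
  ring

end Series

/-! ### Derivatives of the thin-plate spline -/

/-- On the real line the principal logarithm is locally the real logarithm up to a constant, also
at negative points. -/
theorem clog_ofReal_eventuallyEq {τ : ℝ} (hτ : τ ≠ 0) :
    (fun t : ℝ => Complex.log t) =ᶠ[nhds τ]
      fun t : ℝ => (Real.log t : ℂ) + Complex.arg τ * Complex.I := by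
  have key : ∀ t : ℝ, 0 < τ * t → Complex.log t = (Real.log t : ℂ) + Complex.arg τ * Complex.I := by
    intro t ht
    have harg : Complex.arg t = Complex.arg τ := by
      rcases pos_and_pos_or_neg_and_neg_of_mul_pos ht with ⟨h1, h2⟩ | ⟨h1, h2⟩
      · rw [Complex.arg_ofReal_of_nonneg h1.le, Complex.arg_ofReal_of_nonneg h2.le]
      · rw [Complex.arg_ofReal_of_neg h1, Complex.arg_ofReal_of_neg h2]
    rw [Complex.log, harg, Complex.norm_real, Real.norm_eq_abs, Real.log_abs]
  have hopen : IsOpen {t : ℝ | 0 < τ * t} := isOpen_lt continuous_const (by fun_prop)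
  filter_upwards [hopen.mem_nhds (mul_self_pos.2 hτ)] with t ht
  exact key t ht

theorem contDiffAt_clog_ofReal {τ : ℝ} (hτ : τ ≠ 0) (k : ℕ) :
    ContDiffAt ℝ k (fun t : ℝ => Complex.log t) τ := by
  refine ContDiffAt.congr_of_eventuallyEq ?_ (clog_ofReal_eventuallyEq hτ)
  refine ContDiffAt.add ?_ contDiffAt_const
  exact Complex.ofRealCLM.contDiff.contDiffAt.comp τ (Real.contDiffAt_log.2 hτ)

theorem hasDerivAt_clog_ofReal {τ : ℝ} (hτ : τ ≠ 0) :
    HasDerivAt (fun t : ℝ => Complex.log t) ((τ : ℂ)⁻¹) τ := by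
  refine HasDerivAt.congr_of_eventuallyEq ?_ (clog_ofReal_eventuallyEq hτ)
  simpa using (Real.hasDerivAt_log hτ).ofReal_comp.add_const (Complex.arg τ * Complex.I)

theorem hasDerivAt_ofReal_zpow {τ : ℝ} (hτ : τ ≠ 0) (p : ℤ) :
    HasDerivAt (fun t : ℝ => (t : ℂ) ^ p) (p * (τ : ℂ) ^ (p - 1)) τ :=
  (hasDerivAt_zpow p (τ : ℂ) (Or.inl (Complex.ofReal_ne_zero.2 hτ))).comp_ofReal

theorem iteratedDeriv_succ_clog_ofReal (r : ℕ) :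
    ∀ τ : ℝ, τ ≠ 0 → iteratedDeriv (r + 1) (fun t : ℝ => Complex.log t) τ =
      (-1) ^ r * (r.factorial : ℂ) * (τ : ℂ) ^ (-(r + 1 : ℤ)) := by
  induction r with
  | zero =>
    intro τ hτ
    simp [(hasDerivAt_clog_ofReal hτ).deriv]
  | succ r ih =>
    intro τ hτ
    rw [iteratedDeriv_succ]
    have hev : iteratedDeriv (r + 1) (fun t : ℝ => Complex.log t) =ᶠ[nhds τ]
        fun τ => (-1) ^ r * (r.factorial : ℂ) * (τ : ℂ) ^ (-(r + 1 : ℤ)) := by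
      filter_upwards [isOpen_ne.mem_nhds hτ] with t ht using ih t ht
    rw [hev.deriv_eq, ((hasDerivAt_ofReal_zpow hτ _).const_mul _).deriv, Nat.factorial_succ,
      show (-(r + 1 : ℤ) - 1) = -((r + 1 : ℕ) + 1 : ℤ) by push_cast; ring]
    push_cast
    ring

/-- The falling factorial `N (N - 1) ⋯ (N - k + 1)` as `N! / Γ(N - k + 1)`, which is also correct,
with value `0`, when `k > N`. -/
theorem iteratedDeriv_ofReal_pow (N k : ℕ) :
    ∀ τ : ℝ, τ ≠ 0 → iteratedDeriv k (fun t : ℝ => (t : ℂ) ^ N) τ =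
      (N.factorial : ℂ) * recipGamma (N - k + 1) * (τ : ℂ) ^ (N - k : ℤ) := by
  induction k with
  | zero =>
    intro τ _
    have : (N.factorial : ℂ) ≠ 0 := by exact_mod_cast N.factorial_ne_zero
    simp [recipGamma, Complex.Gamma_nat_eq_factorial, this]
  | succ k ih =>
    intro τ hτ
    rw [iteratedDeriv_succ]
    have hev : iteratedDeriv k (fun t : ℝ => (t : ℂ) ^ N) =ᶠ[nhds τ]
        fun τ => (N.factorial : ℂ) * recipGamma (N - k + 1) * (τ : ℂ) ^ (N - k : ℤ) := by
      filter_upwards [isOpen_ne.mem_nhds hτ] with t ht using ih t ht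
    have hG : recipGamma (N - (k + 1 : ℕ) + 1) = (N - k) * recipGamma (N - k + 1) := by
      have := Complex.one_div_Gamma_eq_self_mul_one_div_Gamma_add_one ((N : ℂ) - k)
      rw [show (N : ℂ) - (k + 1 : ℕ) + 1 = N - k by push_cast; ring, recipGamma, recipGamma]
      simpa using this
    rw [hev.deriv_eq, ((hasDerivAt_ofReal_zpow hτ _).const_mul _).deriv, hG,
      show (N - k - 1 : ℤ) = N - (k + 1 : ℕ) by push_cast; ring]
    push_cast
    ring

theorem contDiffAt_ofReal_pow (N k : ℕ) (τ : ℝ) :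
    ContDiffAt ℝ k (fun t : ℝ => (t : ℂ) ^ N) τ :=
  Complex.ofRealCLM.contDiff.contDiffAt.pow N

theorem contDiffAt_thinPlateSpline (n m : ℕ) {τ : ℝ} (hτ : τ ≠ 0) :
    ContDiffAt ℝ m (thinPlateSpline n) τ :=
  (contDiffAt_ofReal_pow (2 * n) m τ).mul (contDiffAt_clog_ofReal hτ m)

/-- Leibniz' rule for `x ^ (2 n) log x`. -/
theorem iteratedDeriv_thinPlateSpline (n m : ℕ) {τ : ℝ} (hτ : τ ≠ 0) :
    iteratedDeriv m (thinPlateSpline n) τ = Complex.Gamma (2 * n + 1) *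
      ((τ : ℂ) ^ (2 * n - m : ℤ) *
        ((m.factorial : ℂ) * ∑ r ∈ Finset.Icc 1 m,
            (-1) ^ (r - 1) / ((r : ℂ) * ((m - r).factorial : ℂ)) *
              recipGamma (2 * n - m + r + 1) +
          recipGamma (2 * n - m + 1) * Complex.log τ)) := by
  have hf : thinPlateSpline n = fun t : ℝ => Complex.log t * (t : ℂ) ^ (2 * n) := by
    ext t; rw [thinPlateSpline, mul_comm]
  have hτ' : (τ : ℂ) ≠ 0 := Complex.ofReal_ne_zero.2 hτ
  have hG : Complex.Gamma (2 * n + 1) = ((2 * n).factorial : ℂ) := by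
    rw [← Complex.Gamma_nat_eq_factorial]; push_cast; rfl
  rw [hf, iteratedDeriv_fun_mul (contDiffAt_clog_ofReal hτ m)
    (contDiffAt_ofReal_pow (2 * n) m τ), Finset.range_eq_Ico,
    Finset.sum_eq_sum_Ico_succ_bot (Nat.succ_pos m),
    show Finset.Ico (0 + 1) (m + 1) = Finset.Icc 1 m by ext; simp, hG]
  have hterm : ∀ r ∈ Finset.Icc 1 m, (m.choose r : ℂ) *
      iteratedDeriv r (fun t : ℝ => Complex.log t) τ *
      iteratedDeriv (m - r) (fun t : ℝ => (t : ℂ) ^ (2 * n)) τ =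
      ((2 * n).factorial : ℂ) * (τ : ℂ) ^ (2 * n - m : ℤ) * (m.factorial : ℂ) *
        ((-1) ^ (r - 1) / ((r : ℂ) * ((m - r).factorial : ℂ)) *
              recipGamma (2 * n - m + r + 1)) := by
    intro r hr
    obtain ⟨h1, h2⟩ := Finset.mem_Icc.1 hr
    obtain ⟨q, rfl⟩ : ∃ q, r = q + 1 := ⟨r - 1, by omega⟩
    rw [iteratedDeriv_succ_clog_ofReal q τ hτ, iteratedDeriv_ofReal_pow _ _ τ hτ,
      Nat.cast_choose ℂ h2, Nat.factorial_succ,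
      show ((2 * n : ℕ) : ℂ) - ((m - (q + 1) : ℕ) : ℂ) + 1 = 2 * n - m + (q + 1 : ℕ) + 1 by
        push_cast [Nat.cast_sub h2]; ring,
      show (2 * n - m : ℤ) = -(q + 1 : ℤ) + ((2 * n : ℕ) - (m - (q + 1) : ℕ)) by
        push_cast [Nat.cast_sub h2]; ring, zpow_add₀ hτ', Nat.add_sub_cancel]
    have e1 : (q.factorial : ℂ) ≠ 0 := by exact_mod_cast q.factorial_ne_zero
    have e2 : ((m - (q + 1)).factorial : ℂ) ≠ 0 := by exact_mod_cast Nat.factorial_ne_zero _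
    have e3 : ((q + 1 : ℕ) : ℂ) ≠ 0 := by exact_mod_cast q.succ_ne_zero
    rw [Nat.cast_mul]
    field_simp
  rw [Finset.sum_congr rfl hterm, ← Finset.mul_sum, iteratedDeriv_ofReal_pow _ _ τ hτ]
  simp only [Nat.choose_zero_right, Nat.cast_one, iteratedDeriv_zero, Nat.sub_zero]
  push_cast
  ring

/-! ### Hypergeometric form -/

section Hypergeometric

variable {a x β : ℝ} {b : ℂ}

theorem ofReal_add_natCast_ne_zero (hβ : 0 < β) (j : ℕ) : (β : ℂ) + j ≠ 0 := by
  rw [← Complex.ofReal_natCast, ← Complex.ofReal_add, Complex.ofReal_ne_zero]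
  positivity

theorem intervalIntegrable_sub_rpow_mul_ofReal (hβ : 0 < β) (hax : a < x) {f : ℝ → ℂ}
    (hf : ContinuousOn f (Set.Icc a x)) :
    IntervalIntegrable (fun τ : ℝ => (((x - τ) ^ (β - 1) : ℝ) : ℂ) * f τ) volume a x := by
  simpa only [Complex.real_smul] using intervalIntegrable_sub_rpow_smul hβ hax hf

theorem summable_ordinaryHypergeometricSeries_add_one (hb : ∀ j : ℕ, b + j ≠ 0) (hβ : 0 < β)
    (hconv : |x - a| < |a|) :
    Summable fun k : ℕ => ordinaryHypergeometricSeries ℂ (β : ℂ) b (β + 1) k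
      (fun _ => ((a : ℂ) - x) / a) := by
  simp only [ordinaryHypergeometricSeries_add_one _ _ _ (ofReal_add_natCast_ne_zero hβ)]
  exact (summable_pochhammerSymbol hb hβ hconv).mul_left _

theorem ordinaryHypergeometric_add_one (hβ : 0 < β) (z : ℂ) :
    ordinaryHypergeometric (β : ℂ) b (β + 1) z =
      β * ∑' k : ℕ, pochhammerSymbol b k / (k.factorial : ℂ) * z ^ k / (β + k) := by
  rw [← tsum_mul_left]
  exact tsum_congr fun k =>
    ordinaryHypergeometricSeries_add_one _ _ _ (ofReal_add_natCast_ne_zero hβ) k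

/-- The Riemann–Liouville integral of order `β` of `τ ^ s (A + B log τ)`. -/
theorem rlIntegral_zpow_mul_log (hβ : 0 < β) (hax : a < x) (hconv : |x - a| < |a|)
    (s : ℤ) (hbs : b = β + s + 1) (hb : ∀ j : ℕ, b + j ≠ 0) (A B : ℂ) :
    rlIntegral a β (fun τ => (τ : ℂ) ^ s * (A + B * Complex.log τ)) x =
      (x : ℂ) ^ (β + s : ℂ) * ((x : ℂ) - a) ^ (β : ℂ) /
          ((a : ℂ) ^ (β : ℂ) * Complex.Gamma (1 + β)) *
        (ordinaryHypergeometric (β : ℂ) b (β + 1) (((a : ℂ) - x) / a) *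
            (A + B * (Complex.log x - Complex.digamma b)) +
          β * B * ∑' k : ℕ, pochhammerSymbol b k * Complex.digamma (b + k) / (k.factorial : ℂ) *
            (((a : ℂ) - x) / a) ^ k / (β + k)) := by
  have hβ' : (β : ℂ) ≠ 0 := Complex.ofReal_ne_zero.2 hβ.ne'
  have hΓ : Complex.Gamma β ≠ 0 := Complex.Gamma_ne_zero_of_re_pos (by simpa using hβ)
  rw [rlIntegral, integral_sub_rpow_mul_zpow_mul_log hβ hax hconv s hbs hb,
    ordinaryHypergeometric_add_one hβ, add_comm (1 : ℂ), Complex.Gamma_add_one _ hβ']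
  push_cast
  rw [← Complex.Gamma_ofReal]
  field_simp

end Hypergeometric

theorem mainTheorem6 (n m : ℕ) (α a x : ℝ) (hα : 0 < α) (hαint : ∀ k : ℕ, α ≠ k)
    (hm : m = ⌈α⌉₊) (ha : a ≠ 0) (hax : a < x) (hconv : |x - a| < |a|) :
    -- everything in the formula for the fractional integral is well defined
    (IntervalIntegrable
        (fun τ : ℝ => (((x - τ) ^ (α - 1) : ℝ) : ℂ) * thinPlateSpline n τ) volume a x ∧
      Summable (fun k : ℕ => ordinaryHypergeometricSeries ℂ (α : ℂ) (α + 2 * n + 1) (α + 1) k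
        (fun _ => ((a : ℂ) - x) / a)) ∧
      Summable (fun k : ℕ => pochhammerSymbol (α + 2 * n + 1) k *
        Complex.digamma (α + 2 * n + k + 1) * ((a : ℂ) - x) ^ k /
          ((α + k) * (a : ℂ) ^ k * (k.factorial : ℂ)))) ∧
    -- the fractional integral
    rlIntegral a α (thinPlateSpline n) x =
      (x : ℂ) ^ (2 * n + α : ℂ) * ((x : ℂ) - a) ^ (α : ℂ) /
          ((a : ℂ) ^ (α : ℂ) * Complex.Gamma (1 + α)) *
        (ordinaryHypergeometric (α : ℂ) (α + 2 * n + 1) (α + 1) (((a : ℂ) - x) / a) *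
            (Complex.log x - Complex.digamma (α + 2 * n + 1)) +
          α * ∑' k : ℕ, pochhammerSymbol (α + 2 * n + 1) k *
            Complex.digamma (α + 2 * n + k + 1) * ((a : ℂ) - x) ^ k /
              ((α + k) * (a : ℂ) ^ k * (k.factorial : ℂ))) ∧
    -- everything in the formula for the Caputo derivative is well defined
    ((∀ τ ∈ Set.Icc a x, ContDiffAt ℝ m (thinPlateSpline n) τ) ∧
      IntervalIntegrable
        (fun τ : ℝ => (((x - τ) ^ (m - α - 1) : ℝ) : ℂ) * iteratedDeriv m (thinPlateSpline n) τ)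
        volume a x ∧
      Summable (fun k : ℕ => ordinaryHypergeometricSeries ℂ (m - α : ℂ) (2 * n - α + 1)
        (m - α + 1) k (fun _ => ((a : ℂ) - x) / a)) ∧
      Summable (fun k : ℕ => pochhammerSymbol (2 * n - α + 1) k *
        Complex.digamma (2 * n - α + k + 1) / ((m - α + k) * (a : ℂ) ^ k * (k.factorial : ℂ)) *
          ((a : ℂ) - x) ^ k)) ∧
    -- the Caputo derivative
    caputoDeriv a α (thinPlateSpline n) x =
      Complex.Gamma (2 * n + 1) * (x : ℂ) ^ (2 * n - α : ℂ) * ((x : ℂ) - a) ^ (m - α : ℂ) /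
          ((a : ℂ) ^ (m - α : ℂ) * Complex.Gamma (1 + m - α)) *
        (ordinaryHypergeometric (m - α : ℂ) (2 * n - α + 1) (m - α + 1) (((a : ℂ) - x) / a) *
            ((Complex.log x - Complex.digamma (2 * n - α + 1)) * recipGamma (2 * n - m + 1) +
              (m.factorial : ℂ) * ∑ r ∈ Finset.Icc 1 m,
                (-1) ^ (r - 1) / ((r : ℂ) * ((m - r).factorial : ℂ)) *
                  recipGamma (2 * n - m + r + 1)) +
          (m - α) * recipGamma (2 * n - m + 1) *
            ∑' k : ℕ, pochhammerSymbol (2 * n - α + 1) k *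
              Complex.digamma (2 * n - α + k + 1) /
                ((m - α + k) * (a : ℂ) ^ k * (k.factorial : ℂ)) * ((a : ℂ) - x) ^ k) := by
  have hm1 : (m : ℝ) - α > 0 := by
    have h1 : α ≤ m := hm ▸ Nat.le_ceil α
    exact sub_pos.2 (lt_of_le_of_ne h1 (hαint m))
  have hne : ∀ τ ∈ Set.Icc a x, τ ≠ 0 := fun τ hτ => ne_zero_of_mem_Icc hax hconv hτ
  have hlog : ContinuousOn (fun τ : ℝ => Complex.log τ) (Set.Icc a x) := fun τ hτ =>
    (contDiffAt_clog_ofReal (hne τ hτ) 0).continuousAt.continuousWithinAt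
  -- the second parameters of the two hypergeometric series are not nonpositive integers
  have hb1 : ∀ j : ℕ, (α + 2 * n + 1 : ℂ) + j ≠ 0 := by
    intro j h
    have : (α + 2 * n + 1 + j : ℝ) = 0 := by exact_mod_cast h
    have : (0 : ℝ) < α + 2 * n + 1 + j := by positivity
    linarith
  have hb2 : ∀ j : ℕ, (2 * n - α + 1 : ℂ) + j ≠ 0 := by
    intro j h
    apply hαint (2 * n + 1 + j)
    have : (2 * n - α + 1 + j : ℝ) = 0 := by exact_mod_cast h
    push_cast
    linarith
  have hcast : ((m - α : ℝ) : ℂ) = (m : ℂ) - α := by push_cast; rfl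
  have hbs2 : (2 * n - α + 1 : ℂ) = ((m - α : ℝ) : ℂ) + (2 * n - m : ℤ) + 1 := by
    push_cast; ring
  have hterm1 : ∀ k : ℕ, pochhammerSymbol (α + 2 * n + 1) k *
        Complex.digamma (α + 2 * n + k + 1) * ((a : ℂ) - x) ^ k /
          ((α + k) * (a : ℂ) ^ k * (k.factorial : ℂ)) =
      pochhammerSymbol (α + 2 * n + 1) k * Complex.digamma (α + 2 * n + 1 + k) /
        (k.factorial : ℂ) * (((a : ℂ) - x) / a) ^ k / (α + k) := by
    intro k
    rw [show (α + 2 * n + k + 1 : ℂ) = α + 2 * n + 1 + k by ring, div_pow]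
    field_simp
  have hterm2 : ∀ k : ℕ, pochhammerSymbol (2 * n - α + 1) k *
        Complex.digamma (2 * n - α + k + 1) / ((m - α + k) * (a : ℂ) ^ k * (k.factorial : ℂ)) *
          ((a : ℂ) - x) ^ k =
      pochhammerSymbol (2 * n - α + 1) k * Complex.digamma (2 * n - α + 1 + k) /
        (k.factorial : ℂ) * (((a : ℂ) - x) / a) ^ k / (((m - α : ℝ) : ℂ) + k) := by
    intro k
    rw [show (2 * n - α + k + 1 : ℂ) = 2 * n - α + 1 + k by ring, div_pow, hcast]
    field_simp
  simp only [hterm1, hterm2]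
  refine ⟨⟨?_, ?_, ?_⟩, ?_, ⟨?_, ?_, ?_, ?_⟩, ?_⟩
  · refine intervalIntegrable_sub_rpow_mul_ofReal hα hax fun τ hτ => ?_
    exact (contDiffAt_thinPlateSpline n 0 (hne τ hτ)).continuousAt.continuousWithinAt
  · exact summable_ordinaryHypergeometricSeries_add_one hb1 hα hconv
  · exact summable_pochhammerSymbol_mul_digamma hb1 hα hconv
  · have hf : thinPlateSpline n =
        fun τ : ℝ => (τ : ℂ) ^ ((2 * n : ℕ) : ℤ) * (0 + 1 * Complex.log τ) := by
      ext τ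
      rw [thinPlateSpline, zpow_natCast, zero_add, one_mul]
    rw [hf, rlIntegral_zpow_mul_log hα hax hconv (2 * n : ℕ) (by push_cast; ring) hb1,
      zero_add, one_mul, mul_one]
    push_cast
    rw [add_comm (α : ℂ) (2 * n)]
  · exact fun τ hτ => contDiffAt_thinPlateSpline n m (hne τ hτ)
  · refine intervalIntegrable_sub_rpow_mul_ofReal hm1 hax ?_
    refine ContinuousOn.congr ?_ fun τ hτ => iteratedDeriv_thinPlateSpline n m (hne τ hτ)
    refine continuousOn_const.mul (ContinuousOn.mul (fun τ hτ => ?_)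
      (continuousOn_const.add (continuousOn_const.mul hlog)))
    exact (hasDerivAt_ofReal_zpow (hne τ hτ) _).continuousAt.continuousWithinAt
  · have h := summable_ordinaryHypergeometricSeries_add_one hb2 hm1 hconv
    rwa [hcast] at h
  · exact summable_pochhammerSymbol_mul_digamma hb2 hm1 hconv
  · -- the Caputo derivative is the fractional integral of order `m - α` of the `m`-th derivative
    have h := rlIntegral_zpow_mul_log hm1 hax hconv (2 * n - m) hbs2 hb2
      ((m.factorial : ℂ) * ∑ r ∈ Finset.Icc 1 m,
            (-1) ^ (r - 1) / ((r : ℂ) * ((m - r).factorial : ℂ)) *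
              recipGamma (2 * n - m + r + 1))
      (recipGamma (2 * n - m + 1))
    have hcap : caputoDeriv a α (thinPlateSpline n) x = Complex.Gamma (2 * n + 1) *
        rlIntegral a (m - α) (fun τ => (τ : ℂ) ^ (2 * n - m : ℤ) *
          ((m.factorial : ℂ) * ∑ r ∈ Finset.Icc 1 m,
            (-1) ^ (r - 1) / ((r : ℂ) * ((m - r).factorial : ℂ)) *
              recipGamma (2 * n - m + r + 1) +
          recipGamma (2 * n - m + 1) * Complex.log τ)) x := by
      rw [caputoDeriv, rlIntegral, ← hm, mul_left_comm,
        ← intervalIntegral.integral_const_mul (Complex.Gamma (2 * n + 1))]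
      congr 1
      apply intervalIntegral.integral_congr
      intro τ hτ
      rw [Set.uIcc_of_le hax.le] at hτ
      simp only
      rw [iteratedDeriv_thinPlateSpline n m (hne τ hτ)]
      ring
    rw [hcap, h, show ((m - α : ℝ) : ℂ) + (2 * n - m : ℤ) = 2 * n - α by push_cast; ring, hcast,
      show (1 : ℂ) + ((m : ℂ) - α) = 1 + m - α by ring]
    ring
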